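/- Theorem (implicit function theorem for diffeological étale manifolds). Conventions. A domain is an open subset of some $\mathbb{R}^n$, $n\ge 0$; a plot in a diffeological space $X$ is a smooth map from a domain to $X$; subsets carry the subspace diffeology and products the product diffeology. A subset of $X$ is D-open if its preimage under every plot is open. A map $g:X\to Y$ of diffeological spaces is *étale* if every $x\in X$ has a D-open neighbourhood $O\subseteq X$ such that $g$ restricts to a diffeomorphism from $O$ onto a D-open subset of $Y$. A smooth map $\pi:E\to X$ is a *diffeological étale map* if for every plot $P:U\to X$ the pullback $P^*\pi:\{(r,\xi)\in U\times E\mid P(r)=\pi(\xi)\}\to U$, $(r,\xi)\mapsto r$, is étale. A diffeological space $M$ is a *diffeological étale manifold* of dimension $n$ if it is covered by the images of a family of diffeological étale maps from open subsets of $\mathbb{R}^n$ into $M$. The *internal tangent space* $T_xX$ is the colimit, in real vector spaces, of the tangent spaces $T_0U$ over all plots $P:U\to X$ with $0\in U$ and $P(0)=x$, taken along the differentials $dF_0$ of the germs at $0$ of smooth maps $F$ between the domains with $F(0)=0$ and $Q=P\circ F$ near $0$. With $dP_0:T_0U\to T_xX$ the canonical maps, a smooth map $g:X\to Y$ induces the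 linear map $dg_x:T_xX\to T_{g(x)}Y$ determined by $dg_x\circ dP_0=d(g\circ P)_0$. Statement. Let $M$, $N$ and $L$ be diffeological étale manifolds (of possibly different dimensions) and let $f:M\times N\to L$ be a smooth map. For $x\in M$ let $f^x:N\to L$, $f^x(y)=f(x,y)$. Then the linear map $$d(f^x)_y:T_yN\to T_{f(x,y)}L$$ is an isomorphism for every $(x,y)\in M\times N$ if and only if the track map $$(\mathrm{Pr}_1,f):M\times N\to M\times L,\qquad (x,y)\mapsto (x,f(x,y)),$$ is a diffeological étale map. -/

import Mathlib

open Diffeology TopologicalSpace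
open scoped ContDiff Topology

noncomputable section

namespace EtaleDiffeology

universe u v w

/-! Diffeological spaces, smooth maps and the D-topology are Mathlib's `DiffeologicalSpace`,
`DSmooth` and `dTopology`. -/

section Constructions

/-- The subspace diffeology: the plots of a subset are the plots of the ambient space with values
in the subset. -/
instance instSubtype {X : Type u} [DiffeologicalSpace X] (s : X → Prop) :
    DiffeologicalSpace (Subtype s) where
  plots n := {p : EuclideanSpace ℝ (Fin n) → Subtype s | IsPlot (fun r => (p r : X))}
  constant_plots x := isPlot_const (x := (x : X))
  plot_reparam hp hf := isPlot_reparam hp hf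
  locality hp := DiffeologicalSpace.locality hp

/-- The product diffeology: a plot of `X × Y` is a pair of plots. -/
instance instProd {X : Type u} {Y : Type v} [DiffeologicalSpace X] [DiffeologicalSpace Y] :
    DiffeologicalSpace (X × Y) where
  plots n := {p : EuclideanSpace ℝ (Fin n) → X × Y |
    IsPlot (fun r => (p r).1) ∧ IsPlot (fun r => (p r).2)}
  constant_plots x := ⟨isPlot_const (x := x.1), isPlot_const (x := x.2)⟩
  plot_reparam hp hf := ⟨isPlot_reparam hp.1 hf, isPlot_reparam hp.2 hf⟩
  locality hp := by
    constructor
    · refine DiffeologicalSpace.locality fun x => ?_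
      obtain ⟨u, hu, hxu, h⟩ := hp x
      exact ⟨u, hu, hxu, fun hfu hf => (h hfu hf).1⟩
    · refine DiffeologicalSpace.locality fun x => ?_
      obtain ⟨u, hu, hxu, h⟩ := hp x
      exact ⟨u, hu, hxu, fun hfu hf => (h hfu hf).2⟩

/-- The partial map `f^x : y ↦ f (x, y)` of a smooth map on a product is smooth. -/
theorem dSmooth_slice {X : Type u} {Y : Type v} {Z : Type w} [DiffeologicalSpace X]
    [DiffeologicalSpace Y] [DiffeologicalSpace Z] {f : X × Y → Z} (hf : DSmooth f) (x : X) :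
    DSmooth (fun y : Y => f (x, y)) :=
  fun n p hp => hf n (fun r => (x, p r)) ⟨isPlot_const, hp⟩

end Constructions

section Etale

/-- A diffeomorphism: a smooth map with a smooth two-sided inverse. -/
def IsDiffeomorphism {X : Type u} {Y : Type v} [DiffeologicalSpace X] [DiffeologicalSpace Y]
    (f : X → Y) : Prop :=
  DSmooth f ∧ ∃ g : Y → X, DSmooth g ∧ Function.LeftInverse g f ∧ Function.RightInverse g f

/-- A map `f : X → Y` is étale if each point has a D-open neighbourhood `O` such that `f`
restricts to a diffeomorphism from `O` onto a D-open subset `O'` of `Y`. -/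
def IsEtale {X : Type u} {Y : Type v} [DiffeologicalSpace X] [DiffeologicalSpace Y]
    (f : X → Y) : Prop :=
  ∀ x₀ : X, ∃ (O : Set X) (O' : Set Y), IsOpen[dTopology] O ∧ IsOpen[dTopology] O' ∧
    x₀ ∈ O ∧ f x₀ ∈ O' ∧ ∃ h : Set.MapsTo f O O', IsDiffeomorphism h.restrict

/-- A smooth map `π : E → X` is a diffeological étale map if, for every plot `P : U → X` defined on
a domain `U` (that is, every smooth map from an open subset of some `ℝⁿ`), the pullback
`P^*π : {(r, ξ) ∈ U × E | P r = π ξ} → U`, `(r, ξ) ↦ r`, is étale. -/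
def IsDiffeologicalEtale {E : Type u} {X : Type v} [DiffeologicalSpace E] [DiffeologicalSpace X]
    (π : E → X) : Prop :=
  DSmooth π ∧ ∀ (n : ℕ) (U : Opens (EuclideanSpace ℝ (Fin n))) (P : U → X), DSmooth P →
    IsEtale (fun z : Function.Pullback P π => z.fst)

/-- `M` is a diffeological étale `n`-manifold: there is a family (an atlas) of diffeological étale
maps, defined on open subsets of `ℝⁿ`, whose images cover `M`. -/
def IsEtaleManifold (n : ℕ) (M : Type u) [DiffeologicalSpace M] : Prop :=
  ∃ A : Set ((U : Opens (EuclideanSpace ℝ (Fin n))) × (U → M)),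
    (∀ φ ∈ A, IsDiffeologicalEtale φ.2) ∧ ∀ x : M, ∃ φ ∈ A, x ∈ Set.range φ.2

end Etale

section Tangent

/-- A plot of `X`, defined on an open neighbourhood of `0` in some `ℝⁿ` and centered at `x`. -/
structure CenteredPlot {X : Type u} [DiffeologicalSpace X] (x : X) where
  dim : ℕ
  domain : Opens (EuclideanSpace ℝ (Fin dim))
  zero_mem : (0 : EuclideanSpace ℝ (Fin dim)) ∈ domain
  toFun : domain → X
  smooth : DSmooth toFun
  map_zero : toFun ⟨0, zero_mem⟩ = x

/-- The composite of a centered plot with a smooth map. -/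
abbrev CenteredPlot.map {X : Type u} {Y : Type v} [DiffeologicalSpace X] [DiffeologicalSpace Y]
    {f : X → Y} (hf : DSmooth f) {x : X} (P : CenteredPlot x) : CenteredPlot (f x) where
  dim := P.dim
  domain := P.domain
  zero_mem := P.zero_mem
  toFun := f ∘ P.toFun
  smooth := hf.comp P.smooth
  map_zero := congrArg f P.map_zero

/-- `F` represents a germ of a morphism from the centered plot `Q` to the centered plot `P`: on some
open neighbourhood `W` of `0` in the domain of `Q`, it is smooth with values in the domain of `P`
and `Q = P ∘ F`; moreover `F 0 = 0`. -/
def CenteredPlot.IsHom {X : Type u} [DiffeologicalSpace X] {x : X} (Q P : CenteredPlot x)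
    (F : EuclideanSpace ℝ (Fin Q.dim) → EuclideanSpace ℝ (Fin P.dim)) : Prop :=
  F 0 = 0 ∧ ∃ W : Opens (EuclideanSpace ℝ (Fin Q.dim)), 0 ∈ W ∧ ContDiffOn ℝ ∞ F W ∧
    ∀ r ∈ W, ∃ (hQ : r ∈ Q.domain) (hP : F r ∈ P.domain), Q.toFun ⟨r, hQ⟩ = P.toFun ⟨F r, hP⟩

open Classical in
/-- The relations `(Q, v) = (P, dF₀ v)`, one for each morphism `F : Q → P` of centered plots and
each vector `v`, in the direct sum of the tangent spaces `T₀ (dom P) = ℝⁿ`. -/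
def tangentRelations {X : Type u} [DiffeologicalSpace X] (x : X) :
    Submodule ℝ (DirectSum (CenteredPlot x) fun P => EuclideanSpace ℝ (Fin P.dim)) :=
  Submodule.span ℝ {t | ∃ (Q P : CenteredPlot x)
    (F : EuclideanSpace ℝ (Fin Q.dim) → EuclideanSpace ℝ (Fin P.dim))
    (v : EuclideanSpace ℝ (Fin Q.dim)), Q.IsHom P F ∧
    t = DirectSum.lof ℝ (CenteredPlot x) (fun P => EuclideanSpace ℝ (Fin P.dim)) Q v -
      DirectSum.lof ℝ (CenteredPlot x) (fun P => EuclideanSpace ℝ (Fin P.dim)) P (fderiv ℝ F 0 v)}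

/-- The internal tangent space `T_x X`: the colimit, in real vector spaces, of the tangent spaces at
`0` of the domains of the plots centered at `x`, along the differentials at `0` of the morphisms of
germs of centered plots. -/
abbrev InternalTangentSpace {X : Type u} [DiffeologicalSpace X] (x : X) : Type u :=
  (DirectSum (CenteredPlot x) fun P => EuclideanSpace ℝ (Fin P.dim)) ⧸ tangentRelations x

open Classical in
/-- The canonical map `dP₀ : T₀ (dom P) → T_x X` into the colimit. -/
def CenteredPlot.d {X : Type u} [DiffeologicalSpace X] {x : X} (P : CenteredPlot x) :
    EuclideanSpace ℝ (Fin P.dim) →ₗ[ℝ] InternalTangentSpace x :=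
  (tangentRelations x).mkQ ∘ₗ
    DirectSum.lof ℝ (CenteredPlot x) (fun P => EuclideanSpace ℝ (Fin P.dim)) P

theorem CenteredPlot.IsHom.map {X : Type u} {Y : Type v} [DiffeologicalSpace X]
    [DiffeologicalSpace Y] {f : X → Y} (hf : DSmooth f) {x : X} {Q P : CenteredPlot x}
    {F : EuclideanSpace ℝ (Fin Q.dim) → EuclideanSpace ℝ (Fin P.dim)} (h : Q.IsHom P F) :
    (Q.map hf).IsHom (P.map hf) F := by
  obtain ⟨h0, W, hW, hF, hr⟩ := h
  refine ⟨h0, W, hW, hF, fun r hrW => ?_⟩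
  obtain ⟨hQ, hP, he⟩ := hr r hrW
  exact ⟨hQ, hP, congrArg f he⟩

/-- The cocone identity `dP₀ ∘ dF₀ = dQ₀`. -/
theorem CenteredPlot.IsHom.d_comp {X : Type u} [DiffeologicalSpace X] {x : X} {Q P : CenteredPlot x}
    {F : EuclideanSpace ℝ (Fin Q.dim) → EuclideanSpace ℝ (Fin P.dim)} (h : Q.IsHom P F)
    (v : EuclideanSpace ℝ (Fin Q.dim)) : P.d (fderiv ℝ F 0 v) = Q.d v := by
  symm
  refine (Submodule.Quotient.eq (tangentRelations x)).2 (Submodule.subset_span ?_)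
  exact ⟨Q, P, F, v, h, rfl⟩

open Classical in
/-- The internal tangent map `df_x : T_x X → T_{f x} Y` of a smooth map `f`, induced by
`dP₀ ↦ d(f ∘ P)₀` on the colimits. -/
def internalTangentMap {X : Type u} {Y : Type v} [DiffeologicalSpace X] [DiffeologicalSpace Y]
    {f : X → Y} (hf : DSmooth f) (x : X) :
    InternalTangentSpace x →ₗ[ℝ] InternalTangentSpace (f x) :=
  (tangentRelations x).liftQ
    (DirectSum.toModule ℝ (CenteredPlot x) (InternalTangentSpace (f x)) fun P => (P.map hf).d) <| by
    refine Submodule.span_le.2 ?_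
    rintro _ ⟨Q, P, F, v, h, rfl⟩
    rw [SetLike.mem_coe, LinearMap.mem_ker, map_sub, DirectSum.toModule_lof,
      DirectSum.toModule_lof, sub_eq_zero]
    exact ((h.map hf).d_comp v).symm

/-- The characterizing property `df_x ∘ dP₀ = d(f ∘ P)₀` of the internal tangent map. -/
theorem internalTangentMap_d {X : Type u} {Y : Type v} [DiffeologicalSpace X]
    [DiffeologicalSpace Y] {f : X → Y} (hf : DSmooth f) {x : X} (P : CenteredPlot x)
    (v : EuclideanSpace ℝ (Fin P.dim)) : internalTangentMap hf x (P.d v) = (P.map hf).d v := by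
  classical
  unfold internalTangentMap CenteredPlot.d
  exact DirectSum.toModule_lof ℝ (φ := fun P : CenteredPlot x => (P.map hf).d) P v

end Tangent

end EtaleDiffeology

end

namespace EtaleDiffeology

universe u v w

/-! A smooth map is diffeologically étale exactly when germs of plots lift along it, uniquely once
the value at the base point is prescribed (`isDiffeologicalEtale_of_localLifts` and its two
converses). An étale manifold therefore has at each point a chart through which every plot factors
by a unique germ (`IsChartAt`). Such a chart is terminal among centered plots, so the colimit
defining the internal tangent space is the tangent space of its domain (`IsChartAt.bijective_d`).

Along a plot of `M`, charts of `N` and `L` turn `f` into a smooth `F (r, v)`, and `d(f^x)_y` into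
the partial derivative of `F` in `v`. If it is bijective, the implicit function theorem solves `F
(r, β r) = γ r`, which lifts plots along the track map; local injectivity of `(r, v) ↦ (r, F (r,
v))` makes the lifts unique. Conversely, unique lifting passes from the track map to each slice
`f^x`, which then carries a chart at `y` to a chart at `f (x, y)`; in these charts the slice is the
identity. -/

/-! ### Cutoffs, inverse and implicit functions. -/

/-- A smooth map into a neighbourhood of a point that is the identity near that point. -/
theorem exists_contDiff_mem_eventually_eq {E : Type*} [NormedAddCommGroup E] [NormedSpace ℝ E]
    [HasContDiffBump E] {x : E} {s : Set E} (hs : s ∈ 𝓝 x) :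
    ∃ κ : E → E, ContDiff ℝ ∞ κ ∧ (∀ r, κ r ∈ s) ∧ ∀ᶠ r in 𝓝 x, κ r = r := by
  obtain ⟨ε, hε, hb⟩ := Metric.mem_nhds_iff.1 hs
  let b : ContDiffBump x := ⟨ε / 4, ε / 2, by positivity, by linarith⟩
  refine ⟨fun r => x + b r • (r - x), ?_, fun r => hb ?_, ?_⟩
  · exact contDiff_const.add (b.contDiff.smul (contDiff_id.sub contDiff_const))
  · rw [mem_ball_iff_norm, add_sub_cancel_left, norm_smul, Real.norm_of_nonneg b.nonneg]
    by_cases hr : r ∈ Metric.ball x (ε / 2)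
    · rw [mem_ball_iff_norm] at hr
      calc b r * ‖r - x‖ ≤ 1 * ‖r - x‖ := by gcongr; exact b.le_one
        _ < ε := by linarith
    · rw [b.zero_of_le_dist (by simpa using hr), zero_mul]
      exact hε
  · filter_upwards [b.eventuallyEq_one] with r hr
    simp [hr]

/-- The inverse function theorem, with an inverse that is smooth on a whole neighbourhood. -/
theorem exists_contDiffOn_localInverse {A B : Type*} [NormedAddCommGroup A] [NormedSpace ℝ A]
    [CompleteSpace A] [NormedAddCommGroup B] [NormedSpace ℝ B] [CompleteSpace B]
    {Φ : A → B} (hΦ : ContDiff ℝ ∞ Φ) {a : A} (ha : Function.Bijective (fderiv ℝ Φ a)) :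
    (∃ S ∈ 𝓝 a, Set.InjOn Φ S) ∧ ∃ (Ψ : B → A) (T : Set B), T ∈ 𝓝 (Φ a) ∧ ContDiffOn ℝ ∞ Ψ T ∧
      Ψ (Φ a) = a ∧ ∀ b ∈ T, Φ (Ψ b) = b := by
  obtain ⟨e, he⟩ : ∃ e : A ≃L[ℝ] B, (e : A →L[ℝ] B) = fderiv ℝ Φ a :=
    ⟨ContinuousLinearEquiv.ofBijective _ (LinearMap.ker_eq_bot.2 ha.1) (LinearMap.range_eq_top.2 ha.2),
      by ext; rfl⟩
  have hd : HasFDerivAt Φ (e : A →L[ℝ] B) a := he ▸ (hΦ.differentiable (by simp) a).hasFDerivAt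
  let H := hΦ.contDiffAt.toOpenPartialHomeomorph Φ hd (by simp)
  have haH : a ∈ H.source := hΦ.contDiffAt.mem_toOpenPartialHomeomorph_source hd (by simp)
  refine ⟨⟨H.source, H.open_source.mem_nhds haH, H.injOn⟩, H.symm,
    -- Smoothness of the inverse at a point requires an invertible derivative there, so the target
    -- is cut down to the open set where this holds.
    H.target ∩ H.symm ⁻¹' {x | fderiv ℝ Φ x ∈ Set.range ((↑) : (A ≃L[ℝ] B) → A →L[ℝ] B)},
    ?_, ?_, H.left_inv haH, fun b hb => H.right_inv hb.1⟩
  · have hopen : IsOpen {x | fderiv ℝ Φ x ∈ Set.range ((↑) : (A ≃L[ℝ] B) → A →L[ℝ] B)} :=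
      ContinuousLinearEquiv.isOpen.preimage (hΦ.continuous_fderiv (by simp))
    refine (H.symm.isOpen_inter_preimage hopen).mem_nhds ⟨H.map_source haH, e, ?_⟩
    exact he.trans (congrArg (fderiv ℝ Φ) (H.left_inv haH).symm)
  · rintro b ⟨hb, e', he'⟩
    refine (H.contDiffAt_symm hb (f₀' := e') ?_ hΦ.contDiffAt).contDiffWithinAt
    rw [he']
    exact (hΦ.differentiable (by simp) _).hasFDerivAt

/-- The implicit function theorem, together with the local injectivity of `(r, v) ↦ (r, F (r, v))`. -/
theorem exists_implicit {E V W : Type*} [NormedAddCommGroup E] [NormedSpace ℝ E]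
    [CompleteSpace E] [HasContDiffBump E] [NormedAddCommGroup V] [NormedSpace ℝ V]
    [CompleteSpace V] [NormedAddCommGroup W] [NormedSpace ℝ W] [CompleteSpace W]
    {F : E × V → W} (hF : ContDiff ℝ ∞ F) {r₀ : E} {v₀ : V}
    (hbij : Function.Bijective fun v => fderiv ℝ F (r₀, v₀) (0, v)) :
    (∃ S ∈ 𝓝 (r₀, v₀), Set.InjOn (fun p : E × V => (p.1, F p)) S) ∧
      ∀ γ : E → W, ContDiff ℝ ∞ γ → γ r₀ = F (r₀, v₀) →
        ∃ β : E → V, ContDiff ℝ ∞ β ∧ β r₀ = v₀ ∧ ∀ᶠ r in 𝓝 r₀, F (r, β r) = γ r := by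
  have hΦ : ContDiff ℝ ∞ fun p : E × V => (p.1, F p) := contDiff_fst.prodMk hF
  have hd : ∀ p : E × V, fderiv ℝ (fun p : E × V => (p.1, F p)) (r₀, v₀) p =
      (p.1, fderiv ℝ F (r₀, v₀) p) := fun p => by
    rw [(hasFDerivAt_fst.prodMk (hF.differentiable (by simp) _).hasFDerivAt).fderiv]
    rfl
  have hsplit : ∀ p : E × V, fderiv ℝ F (r₀, v₀) p =
      fderiv ℝ F (r₀, v₀) (p.1, 0) + fderiv ℝ F (r₀, v₀) (0, p.2) := fun p => by
    rw [← map_add]; simp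
  -- The derivative is block triangular, with the identity and the bijective partial derivative on
  -- the diagonal.
  have hΦbij : Function.Bijective (fderiv ℝ (fun p : E × V => (p.1, F p)) (r₀, v₀)) := by
    constructor
    · rintro ⟨h, k⟩ ⟨h', k'⟩ he
      rw [hd, hd, Prod.mk.injEq] at he
      obtain ⟨rfl, he⟩ := he
      rw [hsplit, hsplit (_, k')] at he
      exact Prod.ext rfl (hbij.1 (add_left_cancel he))
    · rintro ⟨h, k⟩
      obtain ⟨v, hv⟩ := hbij.2 (k - fderiv ℝ F (r₀, v₀) (h, 0))
      refine ⟨(h, v), ?_⟩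
      rw [hd, hsplit]
      exact Prod.ext rfl (by simp only at hv ⊢; rw [hv]; abel)
  obtain ⟨hinj, Ψ, T, hT, hΨ, hΨa, hΨT⟩ := exists_contDiffOn_localInverse hΦ hΦbij
  refine ⟨hinj, fun γ hγ h0 => ?_⟩
  have hs : {r | (r, γ r) ∈ T} ∈ 𝓝 r₀ := by
    refine (continuous_id.prodMk hγ.continuous).continuousAt.preimage_mem_nhds ?_
    simpa [h0] using hT
  -- Precomposing with `κ` keeps the argument of `Ψ` inside `T` everywhere, so `β` is globally
  -- smooth and its germ at `r₀` is unaffected.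
  obtain ⟨κ, hκ, hκs, hκe⟩ := exists_contDiff_mem_eventually_eq hs
  refine ⟨fun r => (Ψ (κ r, γ (κ r))).2, ?_, ?_, ?_⟩
  · exact (hΨ.comp_contDiff (hκ.prodMk (hγ.comp hκ)) hκs).snd
  · simp only [hκe.self_of_nhds, h0, hΨa]
  · filter_upwards [hκe] with r hr
    have := hΨT _ (hκs r)
    rw [hr] at this ⊢
    rw [Prod.mk.injEq] at this
    have h1 : Ψ (r, γ r) = (r, (Ψ (r, γ r)).2) := Prod.ext this.1 rfl
    rw [← h1]
    exact this.2

/-! ### Étale maps as unique lifting of germs of plots. -/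

section Plots

variable {X : Type u} {Y : Type v} {Z : Type w} [DiffeologicalSpace X] [DiffeologicalSpace Y]
  [DiffeologicalSpace Z]

theorem dSmooth_subtype_val {s : X → Prop} : DSmooth (Subtype.val : Subtype s → X) :=
  fun _ _ hp => hp

theorem dSmooth_fst : DSmooth (Prod.fst : X × Y → X) := fun _ _ hp => hp.1

theorem dSmooth_prodMk {f : X → Y} {g : X → Z} (hf : DSmooth f) (hg : DSmooth g) :
    DSmooth fun x => (f x, g x) :=
  fun n p hp => ⟨hf n p hp, hg n p hp⟩

/-- Every smooth map on a domain has the germ of a plot defined on the whole space. -/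
theorem exists_isPlot_eventually_eq {n : ℕ} {U : Opens (EuclideanSpace ℝ (Fin n))} {P : U → X}
    (hP : DSmooth P) {r₀ : EuclideanSpace ℝ (Fin n)} (hr₀ : r₀ ∈ U) :
    ∃ p : EuclideanSpace ℝ (Fin n) → X, IsPlot p ∧ ∀ᶠ r in 𝓝 r₀, ∃ h : r ∈ U, P ⟨r, h⟩ = p r := by
  obtain ⟨κ, hκ, hκU, hκe⟩ := exists_contDiff_mem_eventually_eq (U.isOpen.mem_nhds hr₀)
  refine ⟨fun r => P ⟨κ r, hκU r⟩, hP _ _ hκ.isPlot, ?_⟩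
  filter_upwards [hκe] with r hr
  have hrU : r ∈ U := hr ▸ hκU r
  exact ⟨hrU, congrArg P (Subtype.ext hr.symm)⟩

/-- Plots lift locally along `π`, through any prescribed point of the fibre. -/
def HasLocalLifts (π : X → Y) : Prop :=
  ∀ (n : ℕ) (p : EuclideanSpace ℝ (Fin n) → Y), IsPlot p →
    ∀ (r₀ : EuclideanSpace ℝ (Fin n)) (ξ : X), π ξ = p r₀ →
      ∃ q : EuclideanSpace ℝ (Fin n) → X, IsPlot q ∧ q r₀ = ξ ∧ ∀ᶠ r in 𝓝 r₀, π (q r) = p r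

/-- Local lifts of plots along `π` are determined near a point by their value at that point. -/
def HasUniqueLocalLifts (π : X → Y) : Prop :=
  ∀ (n : ℕ) (p q : EuclideanSpace ℝ (Fin n) → X), IsPlot p → IsPlot q →
    ∀ r₀ : EuclideanSpace ℝ (Fin n), p r₀ = q r₀ → (∀ᶠ r in 𝓝 r₀, π (p r) = π (q r)) →
      ∀ᶠ r in 𝓝 r₀, p r = q r

/-- The local inverse of the étale pullback is a section; its component in `X` is the lift. -/
theorem IsDiffeologicalEtale.hasLocalLifts {π : X → Y} (hπ : IsDiffeologicalEtale π) :
    HasLocalLifts π := by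
  intro n p hp r₀ ξ hξ
  obtain ⟨O, O', -, hO', hzO, -, h, -, g, hg, hgl, hgr⟩ := hπ.2 n ⊤ (fun r => p r)
    (hp.dSmooth.comp dSmooth_subtype_val) ⟨(⟨r₀, trivial⟩, ξ), hξ.symm⟩
  have hzO' := h hzO
  have hs : {r : EuclideanSpace ℝ (Fin n) |
      (⟨r, trivial⟩ : (⊤ : Opens (EuclideanSpace ℝ (Fin n)))) ∈ O'} ∈ 𝓝 r₀ :=
    (isOpen_iff_preimages_plots.1 hO' n (fun r => ⟨r, trivial⟩) isPlot_id).mem_nhds hzO'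
  obtain ⟨κ, hκ, hκs, hκe⟩ := exists_contDiff_mem_eventually_eq hs
  have hfst : ∀ z : O', (g z).1.1.1 = z.1 := fun z => congrArg Subtype.val (hgr z)
  refine ⟨fun r => (g ⟨⟨κ r, trivial⟩, hκs r⟩).1.1.2, ?_, ?_, ?_⟩
  · exact (hg n (fun r => ⟨⟨κ r, trivial⟩, hκs r⟩) hκ.isPlot).2
  · have h0 : (⟨⟨κ r₀, trivial⟩, hκs r₀⟩ : O') =
        Set.MapsTo.restrict _ _ _ h ⟨⟨(⟨r₀, trivial⟩, ξ), hξ.symm⟩, hzO⟩ :=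
      Subtype.ext (Subtype.ext hκe.self_of_nhds)
    simp only [h0, hgl ⟨_, hzO⟩]
  · filter_upwards [hκe] with r hr
    have := (g ⟨⟨κ r, trivial⟩, hκs r⟩).1.2
    rw [hfst] at this
    exact this.symm.trans (congrArg p hr)

theorem IsDiffeologicalEtale.hasUniqueLocalLifts {π : X → Y} (hπ : IsDiffeologicalEtale π) :
    HasUniqueLocalLifts π := by
  intro n p q hp hq r₀ h0 he
  -- After precomposition with `κ` the projections agree everywhere, so both lifts are sections `s`,
  -- `t` of a single pullback, on which the projection is injective near the base point.
  obtain ⟨κ, hκ, hκs, hκe⟩ := exists_contDiff_mem_eventually_eq he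
  have hκ0 := hκe.self_of_nhds
  obtain ⟨O, O', hO, -, hzO, -, h, -, g, -, hgl, -⟩ := hπ.2 n ⊤ (fun r => π (p (κ r)))
    ((hπ.1.comp (isPlot_reparam hp hκ).dSmooth).comp dSmooth_subtype_val)
    ⟨(⟨r₀, trivial⟩, p r₀), congrArg (fun r => π (p r)) hκ0⟩
  let s : EuclideanSpace ℝ (Fin n) → Function.Pullback
      (fun r : (⊤ : Opens (EuclideanSpace ℝ (Fin n))) => π (p (κ r))) π :=
    fun r => ⟨(⟨r, trivial⟩, p (κ r)), rfl⟩
  let t : EuclideanSpace ℝ (Fin n) → Function.Pullback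
      (fun r : (⊤ : Opens (EuclideanSpace ℝ (Fin n))) => π (p (κ r))) π :=
    fun r => ⟨(⟨r, trivial⟩, q (κ r)), hκs r⟩
  have hsO := isOpen_iff_preimages_plots.1 hO n s ⟨isPlot_id, isPlot_reparam hp hκ⟩
  have htO := isOpen_iff_preimages_plots.1 hO n t ⟨isPlot_id, isPlot_reparam hq hκ⟩
  have hs0 : s r₀ ∈ O := by
    convert hzO using 1
    exact Subtype.ext (Prod.ext rfl (congrArg p hκ0))
  have ht0 : t r₀ ∈ O := by
    convert hzO using 1
    exact Subtype.ext (Prod.ext rfl ((congrArg q hκ0).trans h0.symm))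
  filter_upwards [hκe, hsO.mem_nhds hs0, htO.mem_nhds ht0] with r hr hsr htr
  have hst : (⟨s r, hsr⟩ : O) = ⟨t r, htr⟩ := hgl.injective rfl
  have := congrArg (fun z : O => z.1.1.2) hst
  simpa only [s, t, hr] using this

/-- The sheet through `z₀` is the graph of a local lift `q`. Existence of `q` provides the inverse,
and uniqueness of lifts makes the graph D-open. -/
theorem isDiffeologicalEtale_of_localLifts {π : X → Y} (hπ : DSmooth π) (hl : HasLocalLifts π)
    (hu : HasUniqueLocalLifts π) : IsDiffeologicalEtale π := by
  refine ⟨hπ, fun n U P hP z₀ => ?_⟩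
  obtain ⟨p, hp, hpP⟩ := exists_isPlot_eventually_eq hP z₀.1.1.2
  obtain ⟨q, hq, hq0, hqp⟩ := hl n p hp z₀.1.1.1 z₀.1.2 <| by
    obtain ⟨h, h'⟩ := hpP.self_of_nhds
    exact z₀.2.symm.trans h'
  obtain ⟨W, hWsub, hW, hzW⟩ := eventually_nhds_iff.1 (hpP.and hqp)
  have hWU : ∀ u : U, u.1 ∈ W → P u = π (q u.1) := fun u hu => by
    obtain ⟨⟨h, h1⟩, h2⟩ := hWsub _ hu
    exact h1.trans h2.symm
  refine ⟨{z | z.1.1.1 ∈ W ∧ z.1.2 = q z.1.1.1}, {u | u.1 ∈ W}, ?_, ?_, ⟨hzW, hq0.symm⟩, hzW,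
    fun z hz => hz.1, ?_, fun u => ⟨⟨(u.1, q u.1.1), hWU u.1 u.2⟩, u.2, rfl⟩, ?_, ?_, ?_⟩
  · refine isOpen_iff_preimages_plots.2 fun k s hs => isOpen_iff_mem_nhds.2 fun t₀ ht₀ => ?_
    have hs1 : ContDiff ℝ ∞ fun t => (s t).1.1.1 := IsPlot.contDiff hs.1
    have hsW := (hW.preimage hs1.continuous).mem_nhds ht₀.1
    have hlift : ∀ᶠ t in 𝓝 t₀, π (s t).1.2 = π (q (s t).1.1.1) := by
      filter_upwards [hsW] with t ht
      exact (s t).2.symm.trans (hWU _ ht)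
    exact Filter.inter_mem hsW (hu k _ _ hs.2 (isPlot_reparam hq hs1) t₀ ht₀.2 hlift)
  · refine isOpen_iff_preimages_plots.2 fun k s hs => ?_
    exact hW.preimage (IsPlot.contDiff (p := fun t => (s t).1) hs).continuous
  · exact fun k s hs => hs.1
  · exact fun k s hs => ⟨hs, hq.dSmooth k _ hs⟩
  · rintro ⟨⟨⟨u, ξ⟩, hz⟩, hzW, hzq⟩
    exact Subtype.ext (Subtype.ext (Prod.ext rfl hzq.symm))
  · exact fun u => rfl

end Plots

/-! ### Charts of étale manifolds and their internal tangent spaces. -/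

section Charts

variable {X : Type u} {Y : Type v} [DiffeologicalSpace X] [DiffeologicalSpace Y]

/-- The germ of `p` at `0` is a chart at `x`: plots through `x` factor through it locally, by a
unique germ. -/
structure IsChartAt {n : ℕ} (p : EuclideanSpace ℝ (Fin n) → X) (x : X) : Prop where
  isPlot : IsPlot p
  map_zero : p 0 = x
  exists_lift : ∀ (k : ℕ) (q : EuclideanSpace ℝ (Fin k) → X), IsPlot q →
    ∀ r₀, q r₀ = x → ∃ g : EuclideanSpace ℝ (Fin k) → EuclideanSpace ℝ (Fin n),
      ContDiff ℝ ∞ g ∧ g r₀ = 0 ∧ ∀ᶠ r in 𝓝 r₀, p (g r) = q r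
  eventually_eq : ∀ (k : ℕ) (g h : EuclideanSpace ℝ (Fin k) → EuclideanSpace ℝ (Fin n)),
    ContDiff ℝ ∞ g → ContDiff ℝ ∞ h → ∀ r₀, g r₀ = 0 → h r₀ = 0 →
      (∀ᶠ r in 𝓝 r₀, p (g r) = p (h r)) → ∀ᶠ r in 𝓝 r₀, g r = h r

/-- The chart is `φ` translated to send `0` to `φ u` and cut off so as to be defined on the whole
space; its two universal properties are the lifting properties of `φ`. -/
theorem IsDiffeologicalEtale.exists_isChartAt {n : ℕ} {U : Opens (EuclideanSpace ℝ (Fin n))}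
    {φ : U → X} (hφ : IsDiffeologicalEtale φ) (u : U) :
    ∃ p : EuclideanSpace ℝ (Fin n) → X, IsChartAt p (φ u) := by
  obtain ⟨κ, hκ, hκU, hκe⟩ := exists_contDiff_mem_eventually_eq (U.isOpen.mem_nhds u.2)
  have hκu := hκe.self_of_nhds
  have hτ : ContDiff ℝ ∞ fun r : EuclideanSpace ℝ (Fin n) => κ (u.1 + r) :=
    hκ.comp (contDiff_const.add contDiff_id)
  have hτe : ∀ {k : ℕ} {g : EuclideanSpace ℝ (Fin k) → EuclideanSpace ℝ (Fin n)} {r₀},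
      ContDiff ℝ ∞ g → g r₀ = 0 → ∀ᶠ r in 𝓝 r₀, κ (u.1 + g r) = u.1 + g r := by
    intro k g r₀ hg h0
    have : Filter.Tendsto (fun r => u.1 + g r) (𝓝 r₀) (𝓝 u.1) := by
      simpa [h0] using (continuous_const.add hg.continuous).tendsto (f := fun r => u.1 + g r) r₀
    exact this.eventually hκe
  refine ⟨fun r => φ ⟨κ (u.1 + r), hκU _⟩, hφ.1 _ _ hτ.isPlot, ?_, ?_, ?_⟩
  · exact congrArg φ (Subtype.ext (by simpa using hκu))
  · intro k q hq r₀ h0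
    obtain ⟨σ, hσ, hσ0, hσe⟩ := hφ.hasLocalLifts k q hq r₀ u h0.symm
    have hσ' : ContDiff ℝ ∞ fun r => (σ r).1 := IsPlot.contDiff hσ
    have hg : ContDiff ℝ ∞ fun r => (σ r).1 - u.1 := hσ'.sub contDiff_const
    refine ⟨fun r => (σ r).1 - u.1, hg, by simp [hσ0], ?_⟩
    filter_upwards [hσe, hτe hg (by simp [hσ0])] with r h1 h2
    rw [← h1]
    exact congrArg φ (Subtype.ext (h2.trans (add_sub_cancel _ _)))
  · intro k g h hg hh r₀ hg0 hh0 he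
    have := hφ.hasUniqueLocalLifts k (fun r => ⟨κ (u.1 + g r), hκU _⟩)
      (fun r => ⟨κ (u.1 + h r), hκU _⟩) (hτ.comp hg).isPlot (hτ.comp hh).isPlot r₀
      (by simp [hg0, hh0]) he
    filter_upwards [this, hτe hg hg0, hτe hh hh0] with r h1 h2 h3
    have h4 := congrArg Subtype.val h1
    simp only [h2, h3] at h4
    exact add_left_cancel h4

theorem IsEtaleManifold.exists_isChartAt {n : ℕ} (hX : IsEtaleManifold n X) (x : X) :
    ∃ p : EuclideanSpace ℝ (Fin n) → X, IsChartAt p x := by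
  obtain ⟨A, hA, hcov⟩ := hX
  obtain ⟨φ, hφ, u, rfl⟩ := hcov x
  exact (hA φ hφ).exists_isChartAt u

theorem IsChartAt.comp {n : ℕ} {p : EuclideanSpace ℝ (Fin n) → X} {x : X} (hp : IsChartAt p x)
    {f : X → Y} (hf : DSmooth f) (hl : HasLocalLifts f) (hu : HasUniqueLocalLifts f) :
    IsChartAt (fun r => f (p r)) (f x) where
  isPlot := hf _ _ hp.isPlot
  map_zero := congrArg f hp.map_zero
  exists_lift k q hq r₀ h0 := by
    obtain ⟨q', hq', hq'0, hq'e⟩ := hl k q hq r₀ x h0.symm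
    obtain ⟨g, hg, hg0, hge⟩ := hp.exists_lift k q' hq' r₀ hq'0
    refine ⟨g, hg, hg0, ?_⟩
    filter_upwards [hq'e, hge] with r h1 h2
    rw [h2, h1]
  eventually_eq k g h hg hh r₀ hg0 hh0 he :=
    hp.eventually_eq k g h hg hh r₀ hg0 hh0 <|
      hu k _ _ (isPlot_reparam hp.isPlot hg) (isPlot_reparam hp.isPlot hh) r₀
        (by simp [hg0, hh0]) he

/-- The centered plot given by a chart. -/
abbrev IsChartAt.centeredPlot {n : ℕ} {p : EuclideanSpace ℝ (Fin n) → X} {x : X}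
    (hp : IsChartAt p x) : CenteredPlot x where
  dim := n
  domain := ⊤
  zero_mem := trivial
  toFun r := p r
  smooth := hp.isPlot.dSmooth.comp dSmooth_subtype_val
  map_zero := hp.map_zero

theorem CenteredPlot.isHom_of_eventually {x : X} {Q P : CenteredPlot x}
    {F : EuclideanSpace ℝ (Fin Q.dim) → EuclideanSpace ℝ (Fin P.dim)} (hF : ContDiff ℝ ∞ F)
    (h0 : F 0 = 0) (he : ∀ᶠ r in 𝓝 0, ∃ (hQ : r ∈ Q.domain) (hP : F r ∈ P.domain),
      Q.toFun ⟨r, hQ⟩ = P.toFun ⟨F r, hP⟩) : Q.IsHom P F := by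
  obtain ⟨W, hWsub, hW, h0W⟩ := eventually_nhds_iff.1 he
  exact ⟨h0, ⟨W, hW⟩, h0W, hF.contDiffOn, hWsub⟩

/-- Together with `IsChartAt.isHom_unique`, this makes the chart a terminal object among centered
plots and germs. -/
theorem IsChartAt.exists_isHom {n : ℕ} {p : EuclideanSpace ℝ (Fin n) → X} {x : X}
    (hp : IsChartAt p x) (Q : CenteredPlot x) :
    ∃ F : EuclideanSpace ℝ (Fin Q.dim) → EuclideanSpace ℝ (Fin n),
      ContDiff ℝ ∞ F ∧ Q.IsHom hp.centeredPlot F := by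
  obtain ⟨q, hq, hqe⟩ := exists_isPlot_eventually_eq Q.smooth Q.zero_mem
  obtain ⟨g, hg, hg0, hge⟩ := hp.exists_lift _ q hq 0 <| by
    obtain ⟨h, h'⟩ := hqe.self_of_nhds
    exact h'.symm.trans Q.map_zero
  refine ⟨g, hg, CenteredPlot.isHom_of_eventually hg hg0 ?_⟩
  filter_upwards [hqe, hge] with r ⟨h, h1⟩ h2
  exact ⟨h, trivial, h1.trans h2.symm⟩

theorem CenteredPlot.IsHom.eventually {x : X} {Q P : CenteredPlot x}
    {F : EuclideanSpace ℝ (Fin Q.dim) → EuclideanSpace ℝ (Fin P.dim)} (h : Q.IsHom P F) :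
    ∀ᶠ r in 𝓝 0, ∃ (hQ : r ∈ Q.domain) (hP : F r ∈ P.domain),
      Q.toFun ⟨r, hQ⟩ = P.toFun ⟨F r, hP⟩ := by
  obtain ⟨-, W, h0, -, hW⟩ := h
  exact eventually_nhds_iff.2 ⟨W, hW, W.isOpen, h0⟩

/-- Morphisms are only smooth near `0`, whereas `IsChartAt.eventually_eq` compares globally smooth
maps. -/
theorem CenteredPlot.IsHom.exists_contDiff {x : X} {Q P : CenteredPlot x}
    {F : EuclideanSpace ℝ (Fin Q.dim) → EuclideanSpace ℝ (Fin P.dim)} (h : Q.IsHom P F) :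
    ∃ G : EuclideanSpace ℝ (Fin Q.dim) → EuclideanSpace ℝ (Fin P.dim),
      ContDiff ℝ ∞ G ∧ ∀ᶠ r in 𝓝 0, G r = F r := by
  obtain ⟨-, W, h0, hF, -⟩ := h
  obtain ⟨κ, hκ, hκW, hκe⟩ := exists_contDiff_mem_eventually_eq (W.isOpen.mem_nhds h0)
  exact ⟨F ∘ κ, hF.comp_contDiff hκ hκW, hκe.mono fun r hr => congrArg F hr⟩

theorem CenteredPlot.IsHom.comp {x : X} {R Q P : CenteredPlot x}
    {F : EuclideanSpace ℝ (Fin Q.dim) → EuclideanSpace ℝ (Fin P.dim)}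
    {G : EuclideanSpace ℝ (Fin R.dim) → EuclideanSpace ℝ (Fin Q.dim)} (hF : Q.IsHom P F)
    (hFc : ContDiff ℝ ∞ F) (hG : R.IsHom Q G) (hGc : ContDiff ℝ ∞ G) : R.IsHom P (F ∘ G) := by
  have hG0 := hG.1
  refine isHom_of_eventually (hFc.comp hGc) (by simp [hG0, hF.1]) ?_
  have ht : Filter.Tendsto G (𝓝 0) (𝓝 0) := by
    simpa [hG0] using hGc.continuous.tendsto 0
  filter_upwards [hG.eventually, ht.eventually hF.eventually] with r ⟨h1, h2, h3⟩ ⟨h4, h5, h6⟩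
  exact ⟨h1, h5, h3.trans h6⟩

theorem CenteredPlot.IsHom.congr {x : X} {Q P : CenteredPlot x}
    {F G : EuclideanSpace ℝ (Fin Q.dim) → EuclideanSpace ℝ (Fin P.dim)} (hF : Q.IsHom P F)
    (hG : ContDiff ℝ ∞ G) (he : ∀ᶠ r in 𝓝 0, G r = F r) : Q.IsHom P G := by
  refine isHom_of_eventually hG (he.self_of_nhds.trans hF.1) ?_
  filter_upwards [hF.eventually, he] with r h1 h2
  simpa only [h2] using h1

theorem IsChartAt.isHom_unique {n : ℕ} {p : EuclideanSpace ℝ (Fin n) → X} {x : X}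
    (hp : IsChartAt p x) {Q : CenteredPlot x}
    {F G : EuclideanSpace ℝ (Fin Q.dim) → EuclideanSpace ℝ (Fin n)}
    (hF : Q.IsHom hp.centeredPlot F) (hG : Q.IsHom hp.centeredPlot G) (hFc : ContDiff ℝ ∞ F)
    (hGc : ContDiff ℝ ∞ G) : F =ᶠ[𝓝 0] G := by
  refine hp.eventually_eq _ F G hFc hGc 0 hF.1 hG.1 ?_
  filter_upwards [hF.eventually, hG.eventually] with r ⟨h1, _, h2⟩ ⟨_, _, h3⟩
  exact h2.symm.trans h3

/-- The internal tangent space is the tangent space of any chart. -/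
theorem IsChartAt.bijective_d {n : ℕ} {p : EuclideanSpace ℝ (Fin n) → X} {x : X}
    (hp : IsChartAt p x) : Function.Bijective hp.centeredPlot.d := by
  classical
  choose F hFc hF using hp.exists_isHom
  constructor
  -- The differentials of the terminal morphisms `F Q` form a cocone; the induced map out of the
  -- colimit is a left inverse of the differential of the chart.
  · have hrel : tangentRelations x ≤ LinearMap.ker (DirectSum.toModule ℝ (CenteredPlot x)
        (EuclideanSpace ℝ (Fin n)) fun Q => (fderiv ℝ (F Q) 0).toLinearMap) := by
      refine Submodule.span_le.2 ?_
      rintro _ ⟨R, Q, G, v, hG, rfl⟩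
      rw [SetLike.mem_coe, LinearMap.mem_ker, map_sub, sub_eq_zero, DirectSum.toModule_lof,
        DirectSum.toModule_lof]
      obtain ⟨G', hG'c, hG'e⟩ := hG.exists_contDiff
      have hG' := hG.congr hG'c hG'e
      have he := hp.isHom_unique (hF R) ((hF Q).comp (hFc Q) hG' hG'c) (hFc R) ((hFc Q).comp hG'c)
      have hd : fderiv ℝ G 0 = fderiv ℝ G' 0 := (Filter.EventuallyEq.fderiv_eq hG'e).symm
      rw [hd]
      have hd' := he.fderiv_eq (𝕜 := ℝ)
      rw [fderiv_comp _ ((hFc Q).differentiable (by simp) _) (hG'c.differentiable (by simp) _),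
        hG'.1] at hd'
      exact DFunLike.congr_fun hd' v
    have hid : hp.centeredPlot.IsHom hp.centeredPlot id :=
      CenteredPlot.isHom_of_eventually contDiff_id rfl
        (Filter.Eventually.of_forall fun r => ⟨trivial, trivial, rfl⟩)
    have hFid := (hp.isHom_unique (hF _) hid (hFc _) contDiff_id).fderiv_eq (𝕜 := ℝ)
    refine Function.LeftInverse.injective (g := (tangentRelations x).liftQ _ hrel) fun v => ?_
    have h1 : (tangentRelations x).liftQ _ hrel (hp.centeredPlot.d v) =
        fderiv ℝ (F hp.centeredPlot) 0 v :=
      DirectSum.toModule_lof ℝ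
        (φ := fun Q : CenteredPlot x => (fderiv ℝ (F Q) 0).toLinearMap)
        hp.centeredPlot v
    rw [h1, hFid, fderiv_id]
    rfl
  · intro t
    obtain ⟨t, rfl⟩ := (tangentRelations x).mkQ_surjective t
    induction t using DirectSum.induction_on with
    | zero => exact ⟨0, by simp⟩
    | of Q v => exact ⟨fderiv ℝ (F Q) 0 v, (hF Q).d_comp v⟩
    | add s t hs ht =>
      obtain ⟨a, ha⟩ := hs
      obtain ⟨b, hb⟩ := ht
      exact ⟨a + b, by rw [map_add, map_add, ha, hb]⟩

/-- In charts, the internal tangent map is the derivative of a local representative. -/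
theorem IsChartAt.bijective_internalTangentMap_iff {n l : ℕ} {p : EuclideanSpace ℝ (Fin n) → X}
    {q : EuclideanSpace ℝ (Fin l) → Y} {x : X} {f : X → Y} (hf : DSmooth f) (hp : IsChartAt p x)
    (hq : IsChartAt q (f x)) {F : EuclideanSpace ℝ (Fin n) → EuclideanSpace ℝ (Fin l)}
    (hF : ContDiff ℝ ∞ F) (h0 : F 0 = 0) (he : ∀ᶠ r in 𝓝 0, f (p r) = q (F r)) :
    Function.Bijective (internalTangentMap hf x) ↔ Function.Bijective (fderiv ℝ F 0) := by
  have hom : (hp.centeredPlot.map hf).IsHom hq.centeredPlot F :=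
    CenteredPlot.isHom_of_eventually hF h0 (he.mono fun r hr => ⟨trivial, trivial, hr⟩)
  have hcomm : internalTangentMap hf x ∘ hp.centeredPlot.d = hq.centeredPlot.d ∘ fderiv ℝ F 0 :=
    funext fun v => (internalTangentMap_d hf hp.centeredPlot v).trans (hom.d_comp v).symm
  rw [← Function.Bijective.of_comp_iff _ hp.bijective_d, hcomm,
    Function.Bijective.of_comp_iff' hq.bijective_d]

end Charts

/-! ### Lifting along the track map and along its slices. -/

section Track

theorem HasUniqueLocalLifts.slice {M : Type u} {N : Type v} {L : Type w}
    [DiffeologicalSpace M] [DiffeologicalSpace N] {f : M × N → L}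
    (h : HasUniqueLocalLifts fun p : M × N => (p.1, f p)) (x : M) :
    HasUniqueLocalLifts fun y => f (x, y) := by
  intro n p q hp hq r₀ h0 he
  have := h n (fun r => (x, p r)) (fun r => (x, q r)) ⟨isPlot_const, hp⟩ ⟨isPlot_const, hq⟩ r₀
    (Prod.ext rfl h0) (he.mono fun r hr => Prod.ext rfl hr)
  exact this.mono fun r hr => congrArg Prod.snd hr

variable {M : Type u} {N : Type v} {L : Type w} [DiffeologicalSpace M] [DiffeologicalSpace N]
  [DiffeologicalSpace L] {f : M × N → L}

theorem HasLocalLifts.slice (h : HasLocalLifts fun p : M × N => (p.1, f p)) (x : M) :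
    HasLocalLifts fun y => f (x, y) := by
  intro n p hp r₀ y h0
  obtain ⟨q, hq, hq0, hqe⟩ := h n (fun r => (x, p r)) ⟨isPlot_const, hp⟩ r₀ (x, y)
    (Prod.ext rfl h0)
  refine ⟨fun r => (q r).2, hq.2, congrArg Prod.snd hq0, ?_⟩
  filter_upwards [hqe] with r hr
  rw [Prod.mk.injEq] at hr
  rw [← hr.2, ← hr.1]

/-- In charts, the family of slices `f (a r, ·)` along a plot `a` is represented locally by a smooth
map. -/
theorem exists_local_representative (hf : DSmooth f) {k n l : ℕ}
    {a : EuclideanSpace ℝ (Fin k) → M} (ha : IsPlot a) (r₀ : EuclideanSpace ℝ (Fin k)) {y : N}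
    {p : EuclideanSpace ℝ (Fin n) → N} (hp : IsChartAt p y)
    {q : EuclideanSpace ℝ (Fin l) → L} (hq : IsChartAt q (f (a r₀, y))) :
    ∃ F : EuclideanSpace ℝ (Fin k) × EuclideanSpace ℝ (Fin n) → EuclideanSpace ℝ (Fin l),
      ContDiff ℝ ∞ F ∧ F (r₀, 0) = 0 ∧ ∀ᶠ z in 𝓝 (r₀, 0), q (F z) = f (a z.1, p z.2) := by
  -- Plots are parametrized by some `ℝʲ`, so the product of parameter spaces is replaced by `ℝᵏ⁺ⁿ`.
  let e : EuclideanSpace ℝ (Fin (k + n)) ≃L[ℝ]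
      EuclideanSpace ℝ (Fin k) × EuclideanSpace ℝ (Fin n) :=
    ContinuousLinearEquiv.ofFinrankEq (by simp)
  have hplot : IsPlot fun s => f (a (e s).1, p (e s).2) :=
    hf _ (fun s => (a (e s).1, p (e s).2)) ⟨isPlot_reparam ha e.contDiff.fst,
      isPlot_reparam hp.isPlot e.contDiff.snd⟩
  obtain ⟨g, hg, hg0, hge⟩ := hq.exists_lift _ _ hplot (e.symm (r₀, 0)) (by simp [hp.map_zero])
  refine ⟨g ∘ e.symm, hg.comp e.symm.contDiff, hg0, ?_⟩
  filter_upwards [(e.symm.continuous.tendsto (r₀, 0)).eventually hge] with z hz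
  simpa using hz

/-- The local representative of a family of slices with bijective tangent maps satisfies the
hypothesis of the implicit function theorem. -/
theorem bijective_partial_fderiv (hf : DSmooth f) {k n l : ℕ}
    {a : EuclideanSpace ℝ (Fin k) → M} {r₀ : EuclideanSpace ℝ (Fin k)} {y : N}
    {p : EuclideanSpace ℝ (Fin n) → N} (hp : IsChartAt p y)
    {q : EuclideanSpace ℝ (Fin l) → L} (hq : IsChartAt q (f (a r₀, y)))
    {F : EuclideanSpace ℝ (Fin k) × EuclideanSpace ℝ (Fin n) → EuclideanSpace ℝ (Fin l)}
    (hF : ContDiff ℝ ∞ F) (h0 : F (r₀, 0) = 0)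
    (he : ∀ᶠ z in 𝓝 (r₀, 0), q (F z) = f (a z.1, p z.2))
    (hbij : Function.Bijective (internalTangentMap (dSmooth_slice hf (a r₀)) y)) :
    Function.Bijective fun v => fderiv ℝ F (r₀, 0) (0, v) := by
  have hFs : ContDiff ℝ ∞ fun v => F (r₀, v) := hF.comp (contDiff_const.prodMk contDiff_id)
  have hes : ∀ᶠ v in 𝓝 (0 : EuclideanSpace ℝ (Fin n)), f (a r₀, p v) = q (F (r₀, v)) :=
    ((Continuous.prodMk_right r₀).tendsto 0).eventually he |>.mono fun v hv => hv.symm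
  have hd := (hp.bijective_internalTangentMap_iff (dSmooth_slice hf (a r₀)) hq hFs h0 hes).1 hbij
  have hfd : HasFDerivAt (fun v => F (r₀, v)) ((fderiv ℝ F (r₀, 0)).comp
      (ContinuousLinearMap.inr ℝ (EuclideanSpace ℝ (Fin k)) (EuclideanSpace ℝ (Fin n)))) 0 :=
    (hF.differentiable (by simp) (r₀, 0)).hasFDerivAt.comp 0 (hasFDerivAt_prodMk_right r₀ 0)
  rw [hfd.fderiv] at hd
  exact hd

theorem hasLocalLifts_track (hf : DSmooth f) {n l : ℕ} (hN : IsEtaleManifold n N)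
    (hL : IsEtaleManifold l L)
    (hbij : ∀ x y, Function.Bijective (internalTangentMap (dSmooth_slice hf x) y)) :
    HasLocalLifts fun p : M × N => (p.1, f p) := by
  rintro k c hc r₀ ⟨x, y⟩ h0
  have hx : x = (c r₀).1 := congrArg Prod.fst h0
  subst hx
  obtain ⟨p, hp⟩ := hN.exists_isChartAt y
  obtain ⟨q, hq⟩ := hL.exists_isChartAt (f ((c r₀).1, y))
  obtain ⟨F, hF, hF0, hFe⟩ := exists_local_representative hf (a := fun r => (c r).1) hc.1 r₀ hp hq
  obtain ⟨γ, hγ, hγ0, hγe⟩ := hq.exists_lift k _ hc.2 r₀ (congrArg Prod.snd h0).symm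
  obtain ⟨β, hβ, hβ0, hβe⟩ := (exists_implicit hF (bijective_partial_fderiv hf
    (a := fun r => (c r).1) hp hq hF hF0 hFe (hbij _ _))).2 γ hγ (hγ0.trans hF0.symm)
  -- The first component of a lift is forced; the second is the implicit function `β` read through
  -- the chart `p`.
  refine ⟨fun r => ((c r).1, p (β r)), ⟨hc.1, isPlot_reparam hp.isPlot hβ⟩, ?_, ?_⟩
  · simp only [hβ0, hp.map_zero]
  · have ht : Filter.Tendsto (fun r => (r, β r)) (𝓝 r₀) (𝓝 (r₀, 0)) := by
      simpa only [hβ0, id] using (continuous_id.prodMk hβ.continuous).tendsto r₀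
    filter_upwards [hγe, hβe, ht.eventually hFe] with r h1 h2 h3
    refine Prod.ext rfl ?_
    simp only [← h3, h2, h1]

theorem hasUniqueLocalLifts_track (hf : DSmooth f) {n l : ℕ} (hN : IsEtaleManifold n N)
    (hL : IsEtaleManifold l L)
    (hbij : ∀ x y, Function.Bijective (internalTangentMap (dSmooth_slice hf x) y)) :
    HasUniqueLocalLifts fun p : M × N => (p.1, f p) := by
  intro k c c' hc hc' r₀ h0 he
  obtain ⟨p, hp⟩ := hN.exists_isChartAt (c r₀).2
  obtain ⟨q, hq⟩ := hL.exists_isChartAt (f ((c r₀).1, (c r₀).2))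
  obtain ⟨F, hF, hF0, hFe⟩ := exists_local_representative hf (a := fun r => (c r).1) hc.1 r₀ hp hq
  obtain ⟨S, hS, hSinj⟩ := (exists_implicit hF (bijective_partial_fderiv hf
    (a := fun r => (c r).1) hp hq hF hF0 hFe (hbij _ _))).1
  obtain ⟨β, hβ, hβ0, hβe⟩ := hp.exists_lift k _ hc.2 r₀ rfl
  obtain ⟨β', hβ', hβ'0, hβ'e⟩ := hp.exists_lift k _ hc'.2 r₀ (congrArg Prod.snd h0).symm
  have ht : ∀ {β : EuclideanSpace ℝ (Fin k) → EuclideanSpace ℝ (Fin n)}, ContDiff ℝ ∞ β →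
      β r₀ = 0 → Filter.Tendsto (fun r => (r, β r)) (𝓝 r₀) (𝓝 (r₀, 0)) := fun {β} hβ hβ0 => by
    simpa only [hβ0, id] using (continuous_id.prodMk hβ.continuous).tendsto r₀
  -- Both sides are coordinates in the chart `q` of the same germ of a plot in `L`, hence agree;
  -- injectivity on `S` then gives `β = β'` near `r₀`.
  have hFeq : ∀ᶠ r in 𝓝 r₀, F (r, β r) = F (r, β' r) := by
    refine hq.eventually_eq k _ _ (hF.comp (contDiff_id.prodMk hβ))
      (hF.comp (contDiff_id.prodMk hβ')) r₀ (by simp [hβ0, hF0]) (by simp [hβ'0, hF0]) ?_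
    filter_upwards [he, hβe, hβ'e, (ht hβ hβ0).eventually hFe, (ht hβ' hβ'0).eventually hFe]
      with r h1 h2 h3 h4 h5
    rw [Prod.mk.injEq] at h1
    simp only [Function.comp, id, h4, h5, h2, h3]
    rw [Prod.mk.eta, h1.2, h1.1]
  filter_upwards [he, hβe, hβ'e, hFeq, (ht hβ hβ0).eventually hS, (ht hβ' hβ'0).eventually hS]
    with r h1 h2 h3 h4 h5 h6
  rw [Prod.mk.injEq] at h1
  refine Prod.ext h1.1 ?_
  have := congrArg Prod.snd (hSinj h5 h6 (Prod.ext rfl h4))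
  rw [← h2, ← h3]
  exact congrArg p this

theorem bijective_internalTangentMap_of_localLifts {n : ℕ} (hN : IsEtaleManifold n N) {g : N → L}
    (hg : DSmooth g) (hl : HasLocalLifts g) (hu : HasUniqueLocalLifts g) (y : N) :
    Function.Bijective (internalTangentMap hg y) := by
  obtain ⟨p, hp⟩ := hN.exists_isChartAt y
  -- With `g ∘ p` as the chart at `g y`, the local representative of `g` is the identity.
  rw [hp.bijective_internalTangentMap_iff hg (hp.comp hg hl hu) contDiff_id rfl
    (Filter.Eventually.of_forall fun r => rfl), fderiv_id]
  exact Function.bijective_id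

end Track

end EtaleDiffeology

theorem theorem6p13 {M N L : Type*} [DiffeologicalSpace M] [DiffeologicalSpace N]
    [DiffeologicalSpace L] {m n l : ℕ} (hM : EtaleDiffeology.IsEtaleManifold m M)
    (hN : EtaleDiffeology.IsEtaleManifold n N) (hL : EtaleDiffeology.IsEtaleManifold l L)
    (f : M × N → L) (hf : DSmooth f) :
    (∀ (x : M) (y : N), Function.Bijective
      (EtaleDiffeology.internalTangentMap (EtaleDiffeology.dSmooth_slice hf x) y)) ↔
    EtaleDiffeology.IsDiffeologicalEtale (fun p : M × N => (p.1, f p)) := by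
  constructor
  · intro h
    exact EtaleDiffeology.isDiffeologicalEtale_of_localLifts
      (EtaleDiffeology.dSmooth_prodMk EtaleDiffeology.dSmooth_fst hf)
      (EtaleDiffeology.hasLocalLifts_track hf hN hL h)
      (EtaleDiffeology.hasUniqueLocalLifts_track hf hN hL h)
  · intro h x y
    exact EtaleDiffeology.bijective_internalTangentMap_of_localLifts hN
      (EtaleDiffeology.dSmooth_slice hf x) (h.hasLocalLifts.slice x) (h.hasUniqueLocalLifts.slice x) y
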